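/- Let $(\Omega,\Sigma,\mu)$ be a $\sigma$-finite non-atomic measure space, i.e. there is no $A\in\Sigma$ with $\mu(A)>0$ such that every measurable $B\subset A$ satisfies $\mu(B)=0$ or $\mu(A\setminus B)=0$. Let $L^0$ be the space of $\mu$-a.e. classes of real-valued measurable functions on $\Omega$. For $r:\Omega\to[1,\infty]$, measurable up to a null set, and $u\ge 0$, put $\varphi_r(t,u)=u^{r(t)}$ if $r(t)<\infty$, and, if $r(t)=\infty$, $\varphi_r(t,u)=0$ for $u\le 1$ and $\varphi_r(t,u)=\infty$ for $u>1$. Set $I_r(x)=\int_\Omega\varphi_r(t,|x(t)|)\,d\mu(t)$. The variable exponent (Nakano) space is $$L^{r(\cdot)}=\{x\in L^0: I_r(\lambda x)<\infty\text{ for some }\lambda>0\},\qquad \|x\|_{r(\cdot)}=\inf\{\lambda>0: I_r(x/\lambda)\le 1\}.$$ Let $p,q:\Omega\to[1,\infty)$ be measurable with $q\le p$ a.e., and let $$M(L^{p(\cdot)},L^{q(\cdot)})=\{y\in L^0: xy\in L^{q(\cdot)}\text{ for all }x\in L^{p(\cdot)}\},\qquad \|y\|_M=\sup\{\|xy\|_{q(\cdot)}: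 x\in L^{p(\cdot)},\ \|x\|_{p(\cdot)}\le 1\}.$$ Then $$M(L^{p(\cdot)},L^{q(\cdot)})=L^{r(\cdot)},$$ where $r:\Omega\to[1,\infty]$ is determined a.e. by $\frac1{p(t)}+\frac1{r(t)}=\frac1{q(t)}$ (with $\frac1\infty=0$, so $r(t)=\infty$ where $p(t)=q(t)$). Here equality means that the two spaces coincide as sets and their norms are equivalent: there are constants $c,C>0$ with $c\|y\|_{r(\cdot)}\le\|y\|_M\le C\|y\|_{r(\cdot)}$ for all $y\in L^{r(\cdot)}$. -/

import Mathlib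

open MeasureTheory
open scoped ENNReal NNReal

/-- A measurable set `A` is an atom of `μ` if `μ A > 0` and every measurable `B ⊆ A` satisfies
`μ B = 0` or `μ (A \ B) = 0`. -/
def IsMeasureAtom {Ω : Type*} [MeasurableSpace Ω] (μ : Measure Ω) (A : Set Ω) : Prop :=
  MeasurableSet A ∧ 0 < μ A ∧
    ∀ B : Set Ω, MeasurableSet B → B ⊆ A → μ B = 0 ∨ μ (A \ B) = 0

/-- `μ` is non-atomic: it has no atoms. (Mathlib's `NoAtoms` only says that points are null.) -/
def IsNonAtomic {Ω : Type*} [MeasurableSpace Ω] (μ : Measure Ω) : Prop :=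
  ∀ A : Set Ω, ¬ IsMeasureAtom μ A

noncomputable section

namespace MusielakOrlicz

variable {Ω : Type*} [MeasurableSpace Ω]

/-- The modular `I_φ(x) = ∫ φ(t, |x(t)|) dμ(t)` on `L⁰(μ)`. -/
def modular (μ : Measure Ω) (φ : Ω → ℝ≥0 → ℝ≥0∞) (x : Ω →ₘ[μ] ℝ) : ℝ≥0∞ :=
  ∫⁻ t, φ t ‖x t‖₊ ∂μ

/-- The Musielak–Orlicz space `L^φ`, as a set of classes in `L⁰(μ)`. -/
def space (μ : Measure Ω) (φ : Ω → ℝ≥0 → ℝ≥0∞) : Set (Ω →ₘ[μ] ℝ) :=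
  {x | ∃ l : ℝ, 0 < l ∧ modular μ φ (l • x) < ∞}

/-- The Luxemburg–Nakano norm `inf {l > 0 : I_φ(x / l) ≤ 1}`, with value `∞` when there is no
such `l`. -/
def luxNorm (μ : Measure Ω) (φ : Ω → ℝ≥0 → ℝ≥0∞) (x : Ω →ₘ[μ] ℝ) : ℝ≥0∞ :=
  ⨅ (l : ℝ) (_ : 0 < l) (_ : modular μ φ (l⁻¹ • x) ≤ 1), ENNReal.ofReal l

end MusielakOrlicz

namespace VariableExponent

variable {Ω : Type*} [MeasurableSpace Ω]

/-- The Nakano function `(t, u) ↦ u ^ p(t)` for an exponent with values in `[1, ∞]`; where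
`p(t) = ∞` it is `0` for `u ≤ 1` and `∞` for `u > 1`. -/
def nakano (p : Ω → ℝ≥0∞) (t : Ω) (u : ℝ≥0) : ℝ≥0∞ :=
  if p t = ∞ then (if u ≤ 1 then 0 else ∞) else (u : ℝ≥0∞) ^ (p t).toReal

/-- The variable exponent (Nakano) space `L^{p(·)}`. -/
def space (μ : Measure Ω) (p : Ω → ℝ≥0∞) : Set (Ω →ₘ[μ] ℝ) :=
  MusielakOrlicz.space μ (nakano p)

/-- The Luxemburg–Nakano norm of `L^{p(·)}`. -/
def norm (μ : Measure Ω) (p : Ω → ℝ≥0∞) (x : Ω →ₘ[μ] ℝ) : ℝ≥0∞ :=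
  MusielakOrlicz.luxNorm μ (nakano p) x

end VariableExponent

namespace PointwiseMultiplier

variable {Ω : Type*} [MeasurableSpace Ω] {μ : Measure Ω}

/-- The pointwise multipliers from `X` to `Y`: all `y ∈ L⁰` with `x y ∈ Y` for every `x ∈ X`. -/
def space (X Y : Set (Ω →ₘ[μ] ℝ)) : Set (Ω →ₘ[μ] ℝ) :=
  {y | ∀ x ∈ X, x * y ∈ Y}

/-- The operator norm `sup {‖x y‖_Y : x ∈ X, ‖x‖_X ≤ 1}` of a multiplier. -/
def norm (X : Set (Ω →ₘ[μ] ℝ)) (normX normY : (Ω →ₘ[μ] ℝ) → ℝ≥0∞) (y : Ω →ₘ[μ] ℝ) : ℝ≥0∞ :=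
  ⨆ (x : Ω →ₘ[μ] ℝ) (_ : x ∈ X) (_ : normX x ≤ 1), normY (x * y)

end PointwiseMultiplier

end

/-!
# Pointwise multipliers between variable exponent spaces

Let `1 / p + 1 / r = 1 / q` pointwise, with `p` and `q` finite and `r` possibly infinite.

The inclusion `L^r ⊆ M(L^p, L^q)` and the upper norm estimate follow from the pointwise inequality
`φ_q(ab) ≤ φ_p(a) + φ_r(b)` (`nakano_mul_le_add`): with `m` the right-hand side,
`a ≤ m ^ (1/p)` and `b ≤ m ^ (1/r)`, and these two bounds are meaningful for `r = ∞` as well.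

The converse rests on `exists_modular_le_one_and_one_le_modular_mul`: if `I_r(y) > 1`, there is `x`
with `I_p(x) ≤ 1` and `I_q(xy) ≥ 1`. Since `μ` is `σ`-finite, there is a simple function
`g ≤ φ_r(·, |y|)` whose integral `G` satisfies `1 < G < ∞`; one takes `x = (g / G) ^ (1/p)`.
As `|y| ≥ g ^ (1/r) ≥ (g / G) ^ (1/r)` wherever `g ≠ 0`, it follows that `|xy| ^ q ≥ g / G`.

By homogeneity this gives `‖y‖_r ≤ ‖y‖_M` for every `y`. It also shows `M(L^p, L^q) ⊆ L^r`
by a gliding hump: if no multiple of `y` has finite modular, there are `x_n` with `I_p(x_n) ≤ 1`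
and `I_q(x_n y / a_n) ≥ 1`, where `a_n = 2 ^ (2n + 1)`; the function `x` with
`|x| ^ p = ∑ |2 ^ (-n-1) x_n| ^ p` belongs to `L^p`, dominates every `2 ^ (-n-1) x_n`, and `xy` has
infinite `q`-modular at every scale.
-/

namespace VariableExponent

open MusielakOrlicz

/-! ### The Nakano function -/

section Nakano

variable {Ω : Type*} {p q r : Ω → ℝ≥0∞} {t : Ω}

lemma nakano_of_ne_top (h : p t ≠ ∞) (u : ℝ≥0) :
    nakano p t u = (u : ℝ≥0∞) ^ (p t).toReal := by
  simp [nakano, h]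

lemma nakano_mono (t : Ω) : Monotone (nakano p t) := by
  intro u v huv
  unfold nakano
  split_ifs with h hu hv hv
  · exact le_rfl
  · exact zero_le
  · exact absurd (huv.trans hv) hu
  · exact le_rfl
  · gcongr

/-- Convexity of `u ↦ u ^ p(t)`, in the only form needed: along a segment starting at `0`. -/
lemma nakano_mul_le_of_le_one (h1 : 1 ≤ p t) (h : p t ≠ ∞) {c : ℝ≥0} (hc : c ≤ 1) (u : ℝ≥0) :
    nakano p t (c * u) ≤ c * nakano p t u := by
  have h1' : 1 ≤ (p t).toReal := by
    simpa using ENNReal.toReal_mono h h1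
  rw [nakano_of_ne_top h, nakano_of_ne_top h, ENNReal.coe_mul,
    ENNReal.mul_rpow_of_nonneg _ _ (by linarith)]
  gcongr
  exact ENNReal.rpow_le_self_of_le_one (by exact_mod_cast hc) h1'

/-- The generalized inverse of `u ↦ u ^ r(t)` is `m ↦ m ^ (1/r(t))`, including `r(t) = ∞`, where
`m ^ 0 = 1`. -/
lemma le_rpow_of_nakano_le (h0 : r t ≠ 0) {b : ℝ≥0} {m : ℝ≥0∞} (hm : m ≠ ∞)
    (h : nakano r t b ≤ m) : (b : ℝ≥0∞) ≤ m ^ (r t)⁻¹.toReal := by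
  by_cases hr : r t = ∞
  · by_cases hb : b ≤ 1
    · simpa [hr] using hb
    · simp [nakano, hr, hb, hm] at h
  · rw [nakano_of_ne_top hr] at h
    rw [ENNReal.toReal_inv]
    exact (ENNReal.le_rpow_inv_iff (ENNReal.toReal_pos h0 hr)).2 h

/-- Companion of `le_rpow_of_nakano_le`; for `r(t) = ∞` the condition `g ≠ 0` is what
forces `b > 1`. -/
lemma rpow_le_of_le_nakano (h0 : r t ≠ 0) {b : ℝ≥0} {g : ℝ≥0∞} (hg : g ≠ 0)
    (h : g ≤ nakano r t b) : g ^ (r t)⁻¹.toReal ≤ b := by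
  by_cases hr : r t = ∞
  · by_cases hb : b ≤ 1
    · simp [nakano, hr, hb, hg] at h
    · simpa [hr] using (not_le.1 hb).le
  · rw [nakano_of_ne_top hr] at h
    rw [ENNReal.toReal_inv]
    exact (ENNReal.rpow_inv_le_iff (ENNReal.toReal_pos h0 hr)).2 h

lemma ne_zero_of_inv_add_inv (hq : 1 ≤ q t) (hr : (p t)⁻¹ + (r t)⁻¹ = (q t)⁻¹) : r t ≠ 0 := by
  intro h
  have hq0 : q t ≠ 0 := (zero_lt_one.trans_le hq).ne'
  simp only [h, ENNReal.inv_zero, add_top] at hr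
  exact ENNReal.inv_ne_top.2 hq0 hr.symm

lemma toReal_inv_add_toReal_inv (hp : 1 ≤ p t) (hq : 1 ≤ q t)
    (hr : (p t)⁻¹ + (r t)⁻¹ = (q t)⁻¹) :
    (p t)⁻¹.toReal + (r t)⁻¹.toReal = (q t)⁻¹.toReal := by
  rw [← hr, ENNReal.toReal_add]
  · exact ENNReal.inv_ne_top.2 (zero_lt_one.trans_le hp).ne'
  · exact ENNReal.inv_ne_top.2 (ne_zero_of_inv_add_inv hq hr)

/-- A form of Young's inequality, valid for `r(t) = ∞` too. -/
lemma nakano_mul_le_add (hp : 1 ≤ p t) (hq : 1 ≤ q t) (hq' : q t ≠ ∞)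
    (hr : (p t)⁻¹ + (r t)⁻¹ = (q t)⁻¹) (a b : ℝ≥0) :
    nakano q t (a * b) ≤ nakano p t a + nakano r t b := by
  set m := nakano p t a + nakano r t b with hm
  by_cases hmt : m = ∞
  · simp [hmt]
  have hq0 : q t ≠ 0 := (zero_lt_one.trans_le hq).ne'
  have ha := le_rpow_of_nakano_le (zero_lt_one.trans_le hp).ne' hmt (le_self_add : _ ≤ m)
  have hb := le_rpow_of_nakano_le (ne_zero_of_inv_add_inv hq hr) hmt (le_add_self : _ ≤ m)
  rw [nakano_of_ne_top hq', ENNReal.coe_mul,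
    ← ENNReal.le_rpow_inv_iff (ENNReal.toReal_pos hq0 hq'), ← ENNReal.toReal_inv,
    ← toReal_inv_add_toReal_inv hp hq hr,
    ENNReal.rpow_add_of_nonneg _ _ ENNReal.toReal_nonneg ENNReal.toReal_nonneg]
  exact mul_le_mul' ha hb

/-- The case of near-equality in Young's inequality: if `a ^ p = g / G` with `G ≥ 1` and
`g ≤ φ_r(b)`, then `(ab) ^ q ≥ g / G`. -/
lemma div_le_nakano_mul (hp : 1 ≤ p t) (hp' : p t ≠ ∞) (hq : 1 ≤ q t) (hq' : q t ≠ ∞)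
    (hr : (p t)⁻¹ + (r t)⁻¹ = (q t)⁻¹) {a b : ℝ≥0} {g G : ℝ≥0∞} (hG : 1 ≤ G)
    (ha : nakano p t a = g / G) (hb : g ≤ nakano r t b) :
    g / G ≤ nakano q t (a * b) := by
  by_cases hg : g = 0
  · simp [hg]
  have hp0 : p t ≠ 0 := (zero_lt_one.trans_le hp).ne'
  have hq0 : q t ≠ 0 := (zero_lt_one.trans_le hq).ne'
  rw [nakano_of_ne_top hp'] at ha
  have ha' : (g / G) ^ (p t)⁻¹.toReal ≤ a := by
    rw [ENNReal.toReal_inv, ENNReal.rpow_inv_le_iff (ENNReal.toReal_pos hp0 hp'), ha]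
  have hgG : g / G ≤ g := ENNReal.div_le_of_le_mul (le_mul_of_one_le_right' hG)
  have hb' : (g / G) ^ (r t)⁻¹.toReal ≤ b :=
    (ENNReal.rpow_le_rpow hgG ENNReal.toReal_nonneg).trans
      (rpow_le_of_le_nakano (ne_zero_of_inv_add_inv hq hr) hg hb)
  rw [nakano_of_ne_top hq', ENNReal.coe_mul,
    ← ENNReal.rpow_inv_le_iff (ENNReal.toReal_pos hq0 hq'), ← ENNReal.toReal_inv,
    ← toReal_inv_add_toReal_inv hp hq hr,
    ENNReal.rpow_add_of_nonneg _ _ ENNReal.toReal_nonneg ENNReal.toReal_nonneg]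
  exact mul_le_mul' ha' hb'

end Nakano

/-! ### Modulars and norms -/

variable {Ω : Type*} [MeasurableSpace Ω] {μ : Measure Ω} {p q r : Ω → ℝ≥0∞}

instance : IsScalarTower ℝ (Ω →ₘ[μ] ℝ) (Ω →ₘ[μ] ℝ) where
  smul_assoc c x y := by
    refine AEEqFun.ext ?_
    filter_upwards [AEEqFun.coeFn_mul (c • x) y, AEEqFun.coeFn_smul c x,
      AEEqFun.coeFn_smul c (x * y), AEEqFun.coeFn_mul x y] with t h1 h2 h3 h4
    simp only [smul_eq_mul, h1, h2, h3, h4, Pi.mul_apply, Pi.smul_apply, mul_assoc]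

instance : SMulCommClass ℝ (Ω →ₘ[μ] ℝ) (Ω →ₘ[μ] ℝ) where
  smul_comm c x y := by
    rw [smul_eq_mul, smul_eq_mul, mul_comm x y, mul_comm x (c • y), smul_mul_assoc]

lemma modular_smul_le (hp1 : ∀ t, 1 ≤ p t ∧ p t < ∞) {c : ℝ} (hc : 0 ≤ c) (hc1 : c ≤ 1)
    (x : Ω →ₘ[μ] ℝ) :
    modular μ (nakano p) (c • x) ≤ ENNReal.ofReal c * modular μ (nakano p) x := by
  unfold modular
  rw [← lintegral_const_mul' _ _ ENNReal.ofReal_ne_top]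
  refine lintegral_mono_ae ?_
  filter_upwards [AEEqFun.coeFn_smul c x] with t ht
  have hcc : ‖c‖₊ = c.toNNReal := by
    rw [Real.nnnorm_of_nonneg hc, Real.toNNReal_of_nonneg hc]
  rw [ht, Pi.smul_apply, nnnorm_smul, hcc]
  exact nakano_mul_le_of_le_one (hp1 t).1 (hp1 t).2.ne (Real.toNNReal_le_one.2 hc1) _

lemma ofReal_mul_modular_le (hp1 : ∀ t, 1 ≤ p t ∧ p t < ∞) {c : ℝ} (hc1 : 1 ≤ c)
    (x : Ω →ₘ[μ] ℝ) :
    ENNReal.ofReal c * modular μ (nakano p) x ≤ modular μ (nakano p) (c • x) := by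
  have hc : 0 < c := zero_lt_one.trans_le hc1
  have h := modular_smul_le hp1 (inv_nonneg.2 hc.le) (inv_le_one_of_one_le₀ hc1) (c • x)
  rw [inv_smul_smul₀ hc.ne'] at h
  calc ENNReal.ofReal c * modular μ (nakano p) x
      ≤ ENNReal.ofReal c * (ENNReal.ofReal c⁻¹ * modular μ (nakano p) (c • x)) := by gcongr
    _ = modular μ (nakano p) (c • x) := by
      rw [← mul_assoc, ← ENNReal.ofReal_mul hc.le, mul_inv_cancel₀ hc.ne', ENNReal.ofReal_one,
        one_mul]

lemma modular_mul_mono (z : Ω →ₘ[μ] ℝ) {x x' : Ω →ₘ[μ] ℝ} (h : ∀ᵐ t ∂μ, ‖x t‖₊ ≤ ‖x' t‖₊) :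
    modular μ (nakano q) (x * z) ≤ modular μ (nakano q) (x' * z) := by
  refine lintegral_mono_ae ?_
  filter_upwards [h, AEEqFun.coeFn_mul x z, AEEqFun.coeFn_mul x' z] with t ht h1 h2
  refine nakano_mono t ?_
  rw [h1, h2, Pi.mul_apply, Pi.mul_apply, nnnorm_mul, nnnorm_mul]
  gcongr

lemma measurable_nakano (hp : Measurable p) (hp1 : ∀ t, 1 ≤ p t ∧ p t < ∞) (x : Ω →ₘ[μ] ℝ) :
    Measurable fun t => nakano p t ‖x t‖₊ := by
  simp_rw [fun t => nakano_of_ne_top (hp1 t).2.ne ‖x t‖₊]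
  exact x.measurable.nnnorm.coe_nnreal_ennreal.pow hp.ennreal_toReal

/-- The modular form of Hölder's inequality. -/
lemma modular_mul_le_add (hp : Measurable p)
    (hp1 : ∀ t, 1 ≤ p t ∧ p t < ∞) (hq1 : ∀ t, 1 ≤ q t ∧ q t < ∞)
    (hr : ∀ᵐ t ∂μ, (p t)⁻¹ + (r t)⁻¹ = (q t)⁻¹) (x y : Ω →ₘ[μ] ℝ) :
    modular μ (nakano q) (x * y) ≤ modular μ (nakano p) x + modular μ (nakano r) y := by
  unfold modular
  rw [← lintegral_add_left (measurable_nakano hp hp1 x)]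
  refine lintegral_mono_ae ?_
  filter_upwards [hr, AEEqFun.coeFn_mul x y] with t ht h
  rw [h, Pi.mul_apply, nnnorm_mul]
  exact nakano_mul_le_add (hp1 t).1 (hq1 t).1 (hq1 t).2.ne ht _ _

/-- Every integrable weight `w` is of the form `|x| ^ p` almost everywhere. -/
lemma exists_nakano_eq (hp : Measurable p) (hp1 : ∀ t, 1 ≤ p t ∧ p t < ∞) {w : Ω → ℝ≥0∞}
    (hw : Measurable w) (hw' : ∫⁻ t, w t ∂μ ≠ ∞) :
    ∃ x : Ω →ₘ[μ] ℝ, ∀ᵐ t ∂μ, nakano p t ‖x t‖₊ = w t := by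
  have hm : Measurable fun t => (w t ^ (p t).toReal⁻¹).toReal :=
    (hw.pow hp.ennreal_toReal.inv).ennreal_toReal
  refine ⟨AEEqFun.mk _ hm.aestronglyMeasurable, ?_⟩
  filter_upwards [AEEqFun.coeFn_mk _ (hm.aestronglyMeasurable (μ := μ)), ae_lt_top hw hw']
    with t ht hwt
  have hpos : 0 < (p t).toReal :=
    ENNReal.toReal_pos (zero_lt_one.trans_le (hp1 t).1).ne' (hp1 t).2.ne
  rw [ht, nakano_of_ne_top (hp1 t).2.ne, ← enorm_eq_nnnorm, Real.enorm_of_nonneg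
    ENNReal.toReal_nonneg, ENNReal.ofReal_toReal, ENNReal.rpow_inv_rpow hpos.ne']
  exact ENNReal.rpow_ne_top_of_nonneg (inv_nonneg.2 hpos.le) hwt.ne

lemma norm_le_of_modular_le_one {l : ℝ} (hl : 0 < l) {x : Ω →ₘ[μ] ℝ}
    (h : modular μ (nakano p) (l⁻¹ • x) ≤ 1) : norm μ p x ≤ ENNReal.ofReal l :=
  iInf_le_of_le l <| iInf_le_of_le hl <| iInf_le_of_le h le_rfl

lemma exists_modular_le_one_of_norm_lt {L : ℝ≥0∞} {x : Ω →ₘ[μ] ℝ} (h : norm μ p x < L) :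
    ∃ l : ℝ, 0 < l ∧ ENNReal.ofReal l < L ∧ modular μ (nakano p) (l⁻¹ • x) ≤ 1 := by
  simp only [norm, luxNorm, iInf_lt_iff] at h
  obtain ⟨l, hl, hx, hL⟩ := h
  exact ⟨l, hl, hL, hx⟩

lemma mem_space_of_modular_le_one {x : Ω →ₘ[μ] ℝ} (h : modular μ (nakano p) x ≤ 1) :
    x ∈ space μ p :=
  ⟨1, one_pos, by rw [one_smul]; exact h.trans_lt ENNReal.one_lt_top⟩

/-! ### Elements of `L^r` are multipliers -/

lemma mul_mem_space (hp : Measurable p)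
    (hp1 : ∀ t, 1 ≤ p t ∧ p t < ∞) (hq1 : ∀ t, 1 ≤ q t ∧ q t < ∞)
    (hr : ∀ᵐ t ∂μ, (p t)⁻¹ + (r t)⁻¹ = (q t)⁻¹) {x y : Ω →ₘ[μ] ℝ}
    (hx : x ∈ space μ p) (hy : y ∈ space μ r) : x * y ∈ space μ q := by
  obtain ⟨k, hk, hkx⟩ := hx
  obtain ⟨l, hl, hly⟩ := hy
  refine ⟨k * l, mul_pos hk hl, ?_⟩
  rw [← smul_mul_smul_comm]
  exact (modular_mul_le_add hp hp1 hq1 hr _ _).trans_lt (ENNReal.add_lt_top.2 ⟨hkx, hly⟩)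

lemma multiplier_norm_le (hp : Measurable p)
    (hp1 : ∀ t, 1 ≤ p t ∧ p t < ∞) (hq1 : ∀ t, 1 ≤ q t ∧ q t < ∞)
    (hr : ∀ᵐ t ∂μ, (p t)⁻¹ + (r t)⁻¹ = (q t)⁻¹) (y : Ω →ₘ[μ] ℝ) :
    PointwiseMultiplier.norm (space μ p) (norm μ p) (norm μ q) y ≤ 4 * norm μ r y := by
  refine iSup_le fun x => iSup_le fun _ => iSup_le fun hx => ?_
  obtain ⟨k, hk, hk2, hkx⟩ := exists_modular_le_one_of_norm_lt (hx.trans_lt ENNReal.one_lt_two)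
  have hk2' : k ≤ 2 := by
    have : ENNReal.ofReal k < ENNReal.ofReal 2 := by simpa using hk2
    exact ((ENNReal.ofReal_lt_ofReal_iff two_pos).1 this).le
  suffices h : norm μ q (x * y) / 4 ≤ norm μ r y by
    rwa [ENNReal.div_le_iff' (by norm_num) (by norm_num)] at h
  refine le_iInf fun l => le_iInf fun hl => le_iInf fun hly => ?_
  rw [ENNReal.div_le_iff' (by norm_num) (by norm_num)]
  -- The modular of `x y / (k l)` is at most `1 + 1`, and the extra factor `2` halves it.
  have hkl : 0 < 2 * (k * l) := by positivity
  have hmod : modular μ (nakano q) ((2 * (k * l))⁻¹ • (x * y)) ≤ 1 := by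
    have e : (2 * (k * l))⁻¹ • (x * y) = (2⁻¹ : ℝ) • ((k⁻¹ • x) * (l⁻¹ • y)) := by
      rw [smul_mul_smul_comm, smul_smul, mul_inv, mul_inv]
    rw [e]
    calc modular μ (nakano q) ((2⁻¹ : ℝ) • ((k⁻¹ • x) * (l⁻¹ • y)))
        ≤ ENNReal.ofReal 2⁻¹ * modular μ (nakano q) ((k⁻¹ • x) * (l⁻¹ • y)) :=
          modular_smul_le hq1 (by norm_num) (by norm_num) _
      _ ≤ ENNReal.ofReal 2⁻¹ * (1 + 1) := by
          gcongr
          exact (modular_mul_le_add hp hp1 hq1 hr _ _).trans (add_le_add hkx hly)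
      _ = 1 := by
          rw [ENNReal.ofReal_inv_of_pos two_pos, one_add_one_eq_two, ENNReal.ofReal_ofNat]
          exact ENNReal.inv_mul_cancel (by norm_num) (by norm_num)
  calc norm μ q (x * y) ≤ ENNReal.ofReal (2 * (k * l)) := norm_le_of_modular_le_one hkl hmod
    _ ≤ ENNReal.ofReal (4 * l) := ENNReal.ofReal_le_ofReal (by nlinarith)
    _ = 4 * ENNReal.ofReal l := by
        rw [ENNReal.ofReal_mul (by norm_num), ENNReal.ofReal_ofNat]

/-! ### Multipliers belong to `L^r` -/

lemma exists_modular_le_one_and_one_le_modular_mul [SigmaFinite μ] (hp : Measurable p)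
    (hp1 : ∀ t, 1 ≤ p t ∧ p t < ∞) (hq1 : ∀ t, 1 ≤ q t ∧ q t < ∞)
    (hr : ∀ᵐ t ∂μ, (p t)⁻¹ + (r t)⁻¹ = (q t)⁻¹) {y : Ω →ₘ[μ] ℝ}
    (hy : 1 < modular μ (nakano r) y) :
    ∃ x : Ω →ₘ[μ] ℝ, modular μ (nakano p) x ≤ 1 ∧ 1 ≤ modular μ (nakano q) (x * y) := by
  -- The lower Lebesgue integral is a supremum over simple functions for every integrand, so no
  -- measurability of `r` is involved here.
  obtain ⟨f, hfy, hf⟩ : ∃ f : SimpleFunc Ω ℝ≥0, (∀ t, (f t : ℝ≥0∞) ≤ nakano r t ‖y t‖₊) ∧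
      1 < ∫⁻ t, f t ∂μ := by
    rw [modular, lintegral_eq_nnreal, lt_iSup_iff] at hy
    obtain ⟨f, hf⟩ := hy
    rw [lt_iSup_iff] at hf
    obtain ⟨hfy, hf⟩ := hf
    refine ⟨f, hfy, ?_⟩
    rw [← SimpleFunc.lintegral_eq_lintegral] at hf
    simpa using hf
  obtain ⟨g, hgf, hgt, hg1⟩ := SimpleFunc.exists_lt_lintegral_simpleFunc_of_lt_lintegral hf
  set G := ∫⁻ t, g t ∂μ with hG
  have hG0 : G ≠ 0 := (zero_lt_one.trans hg1).ne'
  have hint : ∫⁻ t, g t / G ∂μ = 1 := by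
    simp_rw [div_eq_mul_inv]
    rw [lintegral_mul_const' _ _ (ENNReal.inv_ne_top.2 hG0), ← hG,
      ENNReal.mul_inv_cancel hG0 hgt.ne]
  obtain ⟨x, hx⟩ := exists_nakano_eq (μ := μ) (w := fun t => g t / G) hp hp1
    (g.measurable.coe_nnreal_ennreal.div_const G) (by rw [hint]; exact ENNReal.one_ne_top)
  refine ⟨x, ?_, ?_⟩
  · rw [modular, lintegral_congr_ae hx, hint]
  · rw [← hint]
    refine lintegral_mono_ae ?_
    filter_upwards [hx, hr, AEEqFun.coeFn_mul x y] with t hxt hrt ht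
    rw [ht, Pi.mul_apply, nnnorm_mul]
    exact div_le_nakano_mul (hp1 t).1 (hp1 t).2.ne (hq1 t).1 (hq1 t).2.ne hrt hg1.le hxt
      (le_trans (by exact_mod_cast hgf t) (hfy t))

lemma norm_le_multiplier_norm [SigmaFinite μ] (hp : Measurable p)
    (hp1 : ∀ t, 1 ≤ p t ∧ p t < ∞) (hq1 : ∀ t, 1 ≤ q t ∧ q t < ∞)
    (hr : ∀ᵐ t ∂μ, (p t)⁻¹ + (r t)⁻¹ = (q t)⁻¹) (y : Ω →ₘ[μ] ℝ) :
    norm μ r y ≤ PointwiseMultiplier.norm (space μ p) (norm μ p) (norm μ q) y := by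
  by_contra! hlt
  obtain ⟨m, hMm, hmr⟩ := ENNReal.lt_iff_exists_nnreal_btwn.1 hlt
  have hm : (0 : ℝ) < m := by
    have : (0 : ℝ≥0∞) < m := bot_le.trans_lt hMm
    exact_mod_cast this
  have h1 : 1 < modular μ (nakano r) ((m : ℝ)⁻¹ • y) := by
    by_contra! h
    exact (norm_le_of_modular_le_one hm h).not_gt (by simpa using hmr)
  obtain ⟨x, hx, hxy⟩ := exists_modular_le_one_and_one_le_modular_mul hp hp1 hq1 hr h1
  have hxn : norm μ p x ≤ 1 := by
    simpa using norm_le_of_modular_le_one one_pos (by simpa using hx)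
  have hN : norm μ q (x * y) < m := by
    refine lt_of_le_of_lt ?_ hMm
    exact le_iSup_of_le x <| le_iSup_of_le (mem_space_of_modular_le_one hx) <|
      le_iSup_of_le hxn le_rfl
  obtain ⟨l, hl, hlm, hlxy⟩ := exists_modular_le_one_of_norm_lt hN
  have hlm' : l < m := by
    rw [← ENNReal.ofReal_coe_nnreal] at hlm
    exact (ENNReal.ofReal_lt_ofReal_iff hm).1 hlm
  -- Enlarging the scale from `l` to `m` makes the modular strictly smaller than `1`.
  have h2 : 1 < l⁻¹ * (m : ℝ) := by
    rw [inv_mul_eq_div]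
    exact (one_lt_div hl).2 hlm'
  have h3 := ofReal_mul_modular_le hq1 h2.le (x * ((m : ℝ)⁻¹ • y))
  rw [mul_smul_comm, smul_smul, mul_assoc, mul_inv_cancel₀ hm.ne', mul_one] at h3
  rw [mul_smul_comm] at hxy
  have h4 : ENNReal.ofReal (l⁻¹ * m) ≤ 1 :=
    (le_mul_of_one_le_right' hxy).trans (h3.trans hlxy)
  exact h2.not_ge (by simpa using h4)

/-- A multiplier belongs to `L^r`, by a gliding hump: otherwise every `y / a_n` has infinite modular
and so a bad partner `x_n`, and one element of `L^p` dominates suitable multiples of all `x_n`. -/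
lemma mem_space_of_multiplier [SigmaFinite μ] (hp : Measurable p)
    (hp1 : ∀ t, 1 ≤ p t ∧ p t < ∞) (hq1 : ∀ t, 1 ≤ q t ∧ q t < ∞)
    (hr : ∀ᵐ t ∂μ, (p t)⁻¹ + (r t)⁻¹ = (q t)⁻¹) {y : Ω →ₘ[μ] ℝ}
    (hy : ∀ x ∈ space μ p, x * y ∈ space μ q) : y ∈ space μ r := by
  by_contra hyr
  have key : ∀ n : ℕ, ∃ x : Ω →ₘ[μ] ℝ, modular μ (nakano p) x ≤ 1 ∧
      1 ≤ modular μ (nakano q) (x * (((2 : ℝ) ^ (2 * n + 1))⁻¹ • y)) := by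
    intro n
    refine exists_modular_le_one_and_one_le_modular_mul hp hp1 hq1 hr ?_
    by_contra! h
    exact hyr ⟨_, by positivity, h.trans_lt ENNReal.one_lt_top⟩
  choose x hx hxy using key
  set c : ℕ → ℝ := fun n => ((2 : ℝ) ^ (n + 1))⁻¹ with hc
  have hc0 : ∀ n, 0 ≤ c n := fun n => by positivity
  have hc1 : ∀ n, c n ≤ 1 := fun n => inv_le_one_of_one_le₀ (one_le_pow₀ one_le_two)
  have hmeas : ∀ n, Measurable fun t => nakano p t ‖(c n • x n) t‖₊ :=
    fun n => measurable_nakano hp hp1 _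
  have hint : ∫⁻ t, ∑' n, nakano p t ‖(c n • x n) t‖₊ ∂μ ≤ 1 := by
    rw [lintegral_tsum fun n => (hmeas n).aemeasurable, ← ENNReal.tsum_two_zpow_neg_add_one]
    refine ENNReal.tsum_le_tsum fun n => ?_
    calc modular μ (nakano p) (c n • x n)
        ≤ ENNReal.ofReal (c n) * modular μ (nakano p) (x n) :=
          modular_smul_le hp1 (hc0 n) (hc1 n) _
      _ ≤ ENNReal.ofReal (c n) * 1 := by gcongr; exact hx n
      _ = (2 : ℝ≥0∞) ^ (-1 - n : ℤ) := by
          rw [mul_one, hc, ENNReal.ofReal_inv_of_pos (by positivity),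
            ENNReal.ofReal_pow zero_le_two, ENNReal.ofReal_ofNat,
            neg_sub_left, ENNReal.zpow_neg]
          exact_mod_cast rfl
  obtain ⟨z, hz⟩ := exists_nakano_eq hp hp1 (Measurable.tsum hmeas)
    (hint.trans_lt ENNReal.one_lt_top).ne
  have hzmem : z ∈ space μ p := by
    refine mem_space_of_modular_le_one ?_
    rw [modular, lintegral_congr_ae hz]
    exact hint
  have hdom : ∀ n, ∀ᵐ t ∂μ, ‖(c n • x n) t‖₊ ≤ ‖z t‖₊ := by
    intro n
    filter_upwards [hz] with t ht
    have h := (ENNReal.le_tsum n).trans_eq ht.symm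
    rw [nakano_of_ne_top (hp1 t).2.ne, nakano_of_ne_top (hp1 t).2.ne, ENNReal.rpow_le_rpow_iff
      (ENNReal.toReal_pos (zero_lt_one.trans_le (hp1 t).1).ne' (hp1 t).2.ne)] at h
    exact_mod_cast h
  obtain ⟨l, hl, hlt⟩ := hy z hzmem
  -- At scale `l` the modular of `z y` is at least `2 ^ n l`, for every `n` with `2 ^ n l ≥ 1`.
  have hlow : ∀ n : ℕ, 1 ≤ 2 ^ n * l →
      ENNReal.ofReal (2 ^ n * l) ≤ modular μ (nakano q) (l • (z * y)) := by
    intro n hn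
    have e : (2 ^ n * l) • (x n * (((2 : ℝ) ^ (2 * n + 1))⁻¹ • y))
        = (c n • x n) * (l • y) := by
      rw [smul_mul_smul_comm, mul_smul_comm, smul_smul]
      congr 1
      simp only [hc]
      field_simp
      ring
    calc ENNReal.ofReal (2 ^ n * l)
        ≤ ENNReal.ofReal (2 ^ n * l) *
          modular μ (nakano q) (x n * (((2 : ℝ) ^ (2 * n + 1))⁻¹ • y)) :=
          le_mul_of_one_le_right' (hxy n)
      _ ≤ modular μ (nakano q) ((c n • x n) * (l • y)) := e ▸ ofReal_mul_modular_le hq1 hn _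
      _ ≤ modular μ (nakano q) (z * (l • y)) := modular_mul_mono _ (hdom n)
      _ = modular μ (nakano q) (l • (z * y)) := by rw [mul_smul_comm]
  obtain ⟨n, hn⟩ := pow_unbounded_of_one_lt
    (max 1 (modular μ (nakano q) (l • (z * y))).toReal / l) (one_lt_two (α := ℝ))
  rw [div_lt_iff₀ hl] at hn
  have h := (ENNReal.ofReal_le_iff_le_toReal hlt.ne).1
    (hlow n ((le_max_left _ _).trans hn.le))
  exact (((le_max_right _ _).trans_lt hn).trans_le h).false

end VariableExponent

theorem mainTheorem2 {Ω : Type*} [MeasurableSpace Ω] (μ : Measure Ω) [SigmaFinite μ]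
    (hμ : IsNonAtomic μ)
    (p q : Ω → ℝ≥0∞) (hp : Measurable p) (hq : Measurable q)
    (hp1 : ∀ t, 1 ≤ p t ∧ p t < ∞) (hq1 : ∀ t, 1 ≤ q t ∧ q t < ∞)
    (hqp : ∀ᵐ t ∂μ, q t ≤ p t)
    (r : Ω → ℝ≥0∞) (hr : ∀ᵐ t ∂μ, (p t)⁻¹ + (r t)⁻¹ = (q t)⁻¹) :
    PointwiseMultiplier.space (VariableExponent.space μ p) (VariableExponent.space μ q)
        = VariableExponent.space μ r ∧
      ∃ c C : ℝ≥0, 0 < c ∧ 0 < C ∧ ∀ y ∈ VariableExponent.space μ r,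
        (c : ℝ≥0∞) * VariableExponent.norm μ r y
            ≤ PointwiseMultiplier.norm (VariableExponent.space μ p)
                (VariableExponent.norm μ p) (VariableExponent.norm μ q) y ∧
          PointwiseMultiplier.norm (VariableExponent.space μ p)
              (VariableExponent.norm μ p) (VariableExponent.norm μ q) y
            ≤ (C : ℝ≥0∞) * VariableExponent.norm μ r y := by
  refine ⟨Set.Subset.antisymm ?_ ?_, 1, 4, one_pos, by norm_num, fun y _ => ⟨?_, ?_⟩⟩
  · exact fun y hy => VariableExponent.mem_space_of_multiplier hp hp1 hq1 hr hy
  · exact fun y hy x hx => VariableExponent.mul_mem_space hp hp1 hq1 hr hx hy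
  · simpa using VariableExponent.norm_le_multiplier_norm hp hp1 hq1 hr y
  · simpa using VariableExponent.multiplier_norm_le hp hp1 hq1 hr y
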